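/- Let $A_1,\dots,A_n\in\mathbb{R}^d$ ($n\ge 1$) be the columns of $A\in\mathbb{R}^{d\times n}$ with $\|A_i\|_2\le R$ for all $i$, let $\lambda,\gamma,\eta>0$, let $g:\mathbb{R}^d\to\mathbb{R}$ be $1$-strongly convex and let each $\phi_i:\mathbb{R}\to\mathbb{R}$ be $1/\gamma$-smooth and $1/\eta$-strongly convex. With $h^*$ denoting the convex conjugate of $h$, put $$P(w)=\frac1n\sum_{i=1}^n\phi_i(A_i^Tw)+\lambda g(w),\qquad D(x)=\frac1n\sum_{i=1}^n-\phi_i^*(-x_i)-\lambda g^*\Bigl(\frac1{\lambda n}Ax\Bigr).$$ Then $D$ has a unique maximizer $x^\star$ over $\mathbb{R}^n$. Apply the APCG method described below to $F=-D=f+\Psi$ with $$f(x)=\lambda g^*\Bigl(\frac{1}{\lambda n}Ax\Bigr)+\frac{\gamma}{2n}\|x\|_2^2,\qquad \Psi(x)=\sum_{i=1}^n\Psi_i(x_i),\quad \Psi_i(t)=\frac1n\Bigl(\phi_i^*(-t)-\frac{\gamma}{2}t^2\Bigr),$$ $$L_i=\frac{\|A_i\|_2^2}{\lambda n^2}+\frac{\gamma}{n},\qquad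 \mu=\frac{\lambda\gamma n}{R^2+\lambda\gamma n},\qquad \gamma_0=\mu .$$ The method starts from an arbitrary $x^{(0)}=z^{(0)}\in\mathbb{R}^n$. For $k=0,1,2,\dots$ let $\alpha_k>0$ solve $n^2\alpha_k^2=(1-\alpha_k)\gamma_k+\alpha_k\mu$ and let $\gamma_{k+1}=(1-\alpha_k)\gamma_k+\alpha_k\mu$, $\beta_k=\alpha_k\mu/\gamma_{k+1}$, $y^{(k)}=(\alpha_k\gamma_kz^{(k)}+\gamma_{k+1}x^{(k)})/(\alpha_k\gamma_k+\gamma_{k+1})$; draw $i_k\in\{1,\dots,n\}$ uniformly, independently of the past; and, with $\|v\|_L^2=\sum_iL_iv_i^2$, set $$z^{(k+1)}=\operatorname*{arg\,min}_{v\in\mathbb{R}^n}\Bigl\{\frac{n\alpha_k}{2}\bigl\|v-(1-\beta_k)z^{(k)}-\beta_ky^{(k)}\bigr\|_L^2+\nabla_{i_k}f(y^{(k)})\,v_{i_k}+\Psi_{i_k}(v_{i_k})\Bigr\},$$ $$x^{(k+1)}=y^{(k)}+n\alpha_k(z^{(k+1)}-z^{(k)})+\frac{\mu}{n}(z^{(k)}-y^{(k)}).$$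 Let $w^{(k)}=\nabla g^*\bigl(\frac1{\lambda n}Ax^{(k)}\bigr)$ and $C=D(x^\star)-D(x^{(0)})+\frac{\gamma}{2n}\|x^{(0)}-x^\star\|_2^2$, and let $\|A\|_2$ be the spectral norm. Then for every $\epsilon>0$ and every integer $k\ge0$ with $$k\ \ge\ \Bigl(n+\sqrt{\frac{nR^2}{\lambda\gamma}}\Bigr)\log\Bigl(\frac{\lambda\eta n+\|A\|_2^2}{\lambda\gamma n}\cdot\frac{C}{\epsilon}\Bigr)$$ the expected primal-dual gap satisfies $\mathbb{E}\bigl[P(w^{(k)})-D(x^{(k)})\bigr]\le\epsilon$. (If $C=0$, the condition on $k$ is void.) -/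

import Mathlib

open Real Set MeasureTheory ProbabilityTheory

/-! ### Convex analysis -/

/-- The convex conjugate `h⋆ u = sup_z (⟪z, u⟫ - h z)`. The supremum is finite for every `u` as soon
as `h` is a strongly convex function on a finite-dimensional space, the only case used below. -/
noncomputable def convexConj {E : Type*} [NormedAddCommGroup E] [InnerProductSpace ℝ E]
    (h : E → ℝ) (u : E) : ℝ :=
  ⨆ z : E, (inner ℝ z u - h z)

/-- `h : ℝ → ℝ` is `K`-smooth: differentiable with a `K`-Lipschitz derivative. -/
def IsSmoothFun (K : ℝ) (h : ℝ → ℝ) : Prop :=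
  Differentiable ℝ h ∧ ∀ a b : ℝ, |deriv h a - deriv h b| ≤ K * |a - b|

/-- A minimizer of `h` (an arbitrary point if there is none). -/
noncomputable def argMin {E : Type*} [Nonempty E] (h : E → ℝ) : E :=
  Classical.epsilon fun x => ∀ x' : E, h x ≤ h x'

/-! ### The accelerated proximal coordinate gradient method

The method minimizes `f x + ∑ i, Ψ i (x i)` over `x ∈ ℝⁿ`, all blocks being single coordinates.
`L i` are the coordinate-wise Lipschitz constants, `μ` is the convexity parameter handed to the
method, and `γ₀` is the initial value of the sequence `γ_k`. -/

/-- The squared weighted norm `‖x‖_L² = ∑ L_i x_i²`. -/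
def weightedNormSq {n : ℕ} (L : Fin n → ℝ) (x : EuclideanSpace ℝ (Fin n)) : ℝ :=
  ∑ i, L i * x i ^ 2

/-- The positive solution `α` of `n² α² = (1 - α) γ + α μ`. -/
noncomputable def apcgAlpha (n : ℕ) (μ γ : ℝ) : ℝ :=
  (-(γ - μ) + √((γ - μ) ^ 2 + 4 * (n : ℝ) ^ 2 * γ)) / (2 * (n : ℝ) ^ 2)

theorem apcgAlpha_pos {n : ℕ} (hn : 0 < n) (μ : ℝ) {γ : ℝ} (hγ : 0 < γ) :
    0 < apcgAlpha n μ γ := by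
  have hn' : (0 : ℝ) < n := by exact_mod_cast hn
  unfold apcgAlpha
  apply div_pos _ (by positivity)
  have h1 : |γ - μ| < √((γ - μ) ^ 2 + 4 * (n : ℝ) ^ 2 * γ) := by
    rw [← Real.sqrt_sq_eq_abs]
    apply Real.sqrt_lt_sqrt (sq_nonneg _)
    have : 0 < 4 * (n : ℝ) ^ 2 * γ := by positivity
    linarith
  have h2 := le_abs_self (γ - μ)
  linarith

/-- For `γ > 0`, `apcgAlpha` is characterized as the positive root of the defining equation. -/
theorem apcgAlpha_unique {n : ℕ} (hn : 0 < n) (μ : ℝ) {γ : ℝ} (hγ : 0 < γ) (α : ℝ) :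
    (0 < α ∧ (n : ℝ) ^ 2 * α ^ 2 = (1 - α) * γ + α * μ) ↔ α = apcgAlpha n μ γ := by
  have hn' : (0 : ℝ) < n := by exact_mod_cast hn
  have hpos := apcgAlpha_pos hn μ hγ
  have heq : (n : ℝ) ^ 2 * apcgAlpha n μ γ ^ 2
      = (1 - apcgAlpha n μ γ) * γ + apcgAlpha n μ γ * μ := by
    have hs : √((γ - μ) ^ 2 + 4 * (n : ℝ) ^ 2 * γ) ^ 2 = (γ - μ) ^ 2 + 4 * (n : ℝ) ^ 2 * γ :=
      Real.sq_sqrt (by positivity)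
    unfold apcgAlpha
    generalize √((γ - μ) ^ 2 + 4 * (n : ℝ) ^ 2 * γ) = s at hs
    field_simp
    nlinarith
  constructor
  · rintro ⟨h0, h1⟩
    by_contra hne
    have h2 : (α - apcgAlpha n μ γ)
        * ((n : ℝ) ^ 2 * (α + apcgAlpha n μ γ) + γ - μ) = 0 := by nlinarith
    have h3 : (n : ℝ) ^ 2 * (α + apcgAlpha n μ γ) + γ - μ = 0 :=
      (mul_eq_zero.mp h2).resolve_left (sub_ne_zero.mpr hne)
    have h4 : α * ((n : ℝ) ^ 2 * apcgAlpha n μ γ) + γ = 0 := by nlinarith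
    have : 0 < α * ((n : ℝ) ^ 2 * apcgAlpha n μ γ) := by positivity
    linarith
  · rintro rfl
    exact ⟨hpos, heq⟩

/-- The sequence `γ_{k+1} = (1 - α_k) γ_k + α_k μ`. -/
noncomputable def apcgGamma (n : ℕ) (μ γ₀ : ℝ) : ℕ → ℝ
  | 0 => γ₀
  | k + 1 =>
    (1 - apcgAlpha n μ (apcgGamma n μ γ₀ k)) * apcgGamma n μ γ₀ k
      + apcgAlpha n μ (apcgGamma n μ γ₀ k) * μ

/-- The pair `(x^(k), z^(k))` of iterates, when coordinate `i k` is chosen in iteration `k`. -/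
noncomputable def apcg {n : ℕ} (f : EuclideanSpace ℝ (Fin n) → ℝ) (Ψ : Fin n → ℝ → ℝ)
    (L : Fin n → ℝ) (μ γ₀ : ℝ) (x₀ : EuclideanSpace ℝ (Fin n)) (i : ℕ → Fin n) :
    ℕ → EuclideanSpace ℝ (Fin n) × EuclideanSpace ℝ (Fin n)
  | 0 => (x₀, x₀)
  | k + 1 =>
    let x := (apcg f Ψ L μ γ₀ x₀ i k).1
    let z := (apcg f Ψ L μ γ₀ x₀ i k).2
    let γ := apcgGamma n μ γ₀ k
    let γ₁ := apcgGamma n μ γ₀ (k + 1)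
    let α := apcgAlpha n μ γ
    let β := α * μ / γ₁
    let y := (1 / (α * γ + γ₁)) • ((α * γ) • z + γ₁ • x)
    let z₁ := argMin fun v : EuclideanSpace ℝ (Fin n) =>
      n * α / 2 * weightedNormSq L (v - (1 - β) • z - β • y)
        + gradient f y (i k) * v (i k) + Ψ (i k) (v (i k))
    (y + (n * α) • (z₁ - z) + (μ / n) • (z - y), z₁)

/-! ### Regularized empirical risk minimization -/

section ERM

variable {n d : ℕ} (A : Fin n → EuclideanSpace ℝ (Fin d)) (φ : Fin n → ℝ → ℝ)
  (g : EuclideanSpace ℝ (Fin d) → ℝ) (lam gam R : ℝ)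

/-- The linear map `x ↦ A x = ∑ x_i A_i` of the `d × n` matrix with columns `A_i`; its operator norm
is the spectral norm of this matrix. -/
noncomputable def dataMap : EuclideanSpace ℝ (Fin n) →L[ℝ] EuclideanSpace ℝ (Fin d) :=
  ∑ i, (EuclideanSpace.proj (𝕜 := ℝ) i).smulRight (A i)

/-- The primal objective `P(w) = (1/n) ∑ φ_i(A_iᵀ w) + lam g(w)`. -/
noncomputable def primalObj (w : EuclideanSpace ℝ (Fin d)) : ℝ :=
  1 / n * ∑ i, φ i (inner ℝ (A i) w) + lam * g w

/-- The dual objective `D(x) = (1/n) ∑ -φ_i⋆(-x_i) - lam g⋆(A x / (lam n))`. -/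
noncomputable def dualObj (x : EuclideanSpace ℝ (Fin n)) : ℝ :=
  1 / n * ∑ i, -convexConj (φ i) (-x i)
    - lam * convexConj g ((1 / (lam * n)) • dataMap A x)

/-- The primal point `ω(x) = ∇g⋆(A x / (lam n))` associated with a dual point `x`. -/
noncomputable def primalOfDual (x : EuclideanSpace ℝ (Fin n)) : EuclideanSpace ℝ (Fin d) :=
  gradient (convexConj g) ((1 / (lam * n)) • dataMap A x)

/-- The smooth part `f(x) = lam g⋆(A x / (lam n)) + (gam / (2n)) ‖x‖²` of `-D`. -/
noncomputable def ermSmoothPart (x : EuclideanSpace ℝ (Fin n)) : ℝ :=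
  lam * convexConj g ((1 / (lam * n)) • dataMap A x) + gam / (2 * n) * ‖x‖ ^ 2

/-- The separable part `Ψ_i(t) = (1/n) (φ_i⋆(-t) - (gam / 2) t²)` of `-D`. -/
noncomputable def ermSepPart (i : Fin n) (t : ℝ) : ℝ :=
  1 / n * (convexConj (φ i) (-t) - gam / 2 * t ^ 2)

/-- The coordinate-wise Lipschitz constants `L_i = ‖A_i‖² / (lam n²) + gam / n` of the gradient of
the smooth part. -/
noncomputable def ermLip (i : Fin n) : ℝ :=
  ‖A i‖ ^ 2 / (lam * (n : ℝ) ^ 2) + gam / n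

/-- The convexity parameter `μ = lam gam n / (R² + lam gam n)` of the smooth part in the weighted
norm. -/
noncomputable def ermMu (n : ℕ) (lam gam R : ℝ) : ℝ :=
  lam * gam * n / (R ^ 2 + lam * gam * n)

/-- The dual iterate `x^(k)` of the accelerated proximal coordinate gradient method applied to the
minimization of `-D`, with convexity parameter `μ = ermMu` and `γ₀ = μ`. -/
noncomputable def ermIterate (x₀ : EuclideanSpace ℝ (Fin n)) (i : ℕ → Fin n) (k : ℕ) :
    EuclideanSpace ℝ (Fin n) :=
  (apcg (ermSmoothPart A g lam gam) (ermSepPart φ gam) (ermLip A lam gam)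
    (ermMu n lam gam R) (ermMu n lam gam R) x₀ i k).1

end ERM

/-! With `γ₀ = μ` the parameters freeze: `γ_k = μ` and `α_k = β_k = α = √μ / n`. The state carried
is `(p, z)`, where `x = nα z + (1 - nα) p`. The update of `p` averages `p` and `z` without seeing
the drawn coordinate, and convexity gives `Ψ(x) ≤ nα Ψ(z) + (1 - nα) Ψ(p)`. The potential is the
objective gap with `Ψ(x)` replaced by this bound, plus `μ/2 ‖z - x⋆‖_L²`.

Strong convexity of `g` makes `g⋆` 1-smooth, so `f` is `L_i`-smooth in coordinate `i`. Smoothness of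
`φ_i` makes `φ_i⋆` strongly convex with modulus `gam`; moving that quadratic into `f` leaves `Ψ_i`
convex and makes `f` `μ`-strongly convex in `‖·‖_L`. Averaged over the coordinate, one step then
contracts the potential by `1 - α` (`average_apcgPotential_step_le`), and independence of the draws
turns this into geometric decay of the expectation (`integral_iterateWith_le`), starting from at
most `C`.

The duality gap is bounded by the dual suboptimality (`primalObj_sub_dualObj_le`): a step of size
`θ` from `x` towards `t_i = -φ_i'(⟪A_i, w⟫)` raises `D` by at least `θ` times the gap. Since `gam ≤
eta`, `1/θ` is at most the factor in the logarithm, and `one_le_rate_mul` converts the rate into the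
bound on `k`. -/

/-! ### Strongly convex functions -/

section StrongConvex

variable {E : Type*} [NormedAddCommGroup E] [InnerProductSpace ℝ E]

/-- A function with a quadratic minorant touching it at every point is strongly convex. -/
theorem strongConvexOn_of_forall_exists_minorant {m : ℝ} {h : E → ℝ}
    (H : ∀ x, ∃ a : E, ∀ y, h x + inner ℝ a (y - x) + m / 2 * ‖y - x‖ ^ 2 ≤ h y) :
    StrongConvexOn univ m h := by
  refine ⟨convex_univ, fun x _ y _ a b ha hb hab => ?_⟩
  -- In the `a, b` combination of the two minorants the linear terms cancel, and `a b² + b a² = a b`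
  -- gives the modulus.
  obtain ⟨p, hp⟩ := H (a • x + b • y)
  have hx := hp x
  have hy := hp y
  have e1 : x - (a • x + b • y) = b • (x - y) := by
    obtain rfl : a = 1 - b := by linarith
    module
  have e2 : y - (a • x + b • y) = (-a) • (x - y) := by
    obtain rfl : b = 1 - a := by linarith
    module
  rw [e1, norm_smul, inner_smul_right, mul_pow, Real.norm_eq_abs, sq_abs] at hx
  rw [e2, norm_smul, inner_smul_right, mul_pow, Real.norm_eq_abs, sq_abs] at hy
  have hx' := mul_le_mul_of_nonneg_left hx ha
  have hy' := mul_le_mul_of_nonneg_left hy hb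
  simp only [smul_eq_mul]
  obtain rfl : b = 1 - a := by linarith
  nlinarith

/-- Comparing `x` with the point at parameter `t` on the segment to `y` and dividing by `t` loses
only a factor `1 - t` in the quadratic term; then `t → 0`. -/
theorem StrongConvexOn.add_norm_sq_le_of_forall_le {m : ℝ} {h : E → ℝ}
    (hh : StrongConvexOn univ m h) {x : E} (hx : ∀ y, h x ≤ h y) (y : E) :
    h x + m / 2 * ‖y - x‖ ^ 2 ≤ h y := by
  have key : ∀ t ∈ Ioo (0 : ℝ) 1, m / 2 * ‖y - x‖ ^ 2 * (1 - t) ≤ h y - h x := by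
    rintro t ⟨h0, h1⟩
    have h2 := hh.2 (mem_univ y) (mem_univ x) h0.le (sub_nonneg.2 h1.le) (by ring)
    have h3 := hx (t • y + (1 - t) • x)
    simp only [smul_eq_mul] at h2
    have h4 : t * (m / 2 * ‖y - x‖ ^ 2 * (1 - t)) ≤ t * (h y - h x) := by linarith
    exact le_of_mul_le_mul_left h4 h0
  have hlim : Filter.Tendsto (fun t : ℝ => m / 2 * ‖y - x‖ ^ 2 * (1 - t)) (nhdsWithin 0 (Ioi 0))
      (nhds (m / 2 * ‖y - x‖ ^ 2 * (1 - 0))) :=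
    ((by fun_prop : Continuous fun t : ℝ => m / 2 * ‖y - x‖ ^ 2 * (1 - t)).tendsto 0).mono_left
      nhdsWithin_le_nhds
  have := le_of_tendsto hlim (Filter.mem_of_superset (Ioo_mem_nhdsGT one_pos) key)
  linarith

/-- Let `B` bound `h` below on the unit ball. Strong convexity at the unit vector on the segment
from `0` to `y` forces `h y ≥ h 0` once `‖y‖ ≥ 1 + 2 (h 0 - B) / m`, so a minimizer exists by
compactness. -/
theorem StrongConvexOn.exists_forall_le [FiniteDimensional ℝ E] {m : ℝ} (hm : 0 < m) {h : E → ℝ}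
    (hh : StrongConvexOn univ m h) : ∃ x, ∀ y, h x ≤ h y := by
  have hcont : Continuous h := continuousOn_univ.1
    (ConvexOn.continuousOn isOpen_univ (UniformConvexOn.convexOn hh fun r => by positivity))
  obtain ⟨B, hB⟩ : ∃ B, ∀ y, ‖y‖ ≤ 1 → B ≤ h y := by
    obtain ⟨x, -, hx⟩ := (isCompact_closedBall (0 : E) 1).exists_isMinOn
      ⟨0, by simp⟩ hcont.continuousOn
    exact ⟨h x, fun y hy => hx (by simpa using hy)⟩
  refine hcont.exists_forall_le' 0 ?_
  have hev := tendsto_norm_cocompact_atTop (E := E)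
    |>.eventually_ge_atTop (1 + 2 / m * (h 0 - B))
  filter_upwards [hev] with y hy
  have hB0 : B ≤ h 0 := hB 0 (by simp)
  have hpos : 0 ≤ 2 / m * (h 0 - B) := mul_nonneg (by positivity) (by linarith)
  have hy1 : 1 ≤ ‖y‖ := by linarith
  have hy0 : 0 < ‖y‖ := by linarith
  have hinv : ‖y‖⁻¹ ≤ 1 := inv_le_one_of_one_le₀ hy1
  have h1 := hh.2 (mem_univ y) (mem_univ 0) (inv_nonneg.2 hy0.le) (sub_nonneg.2 hinv) (by ring)
  have h2 := hB (‖y‖⁻¹ • y + (1 - ‖y‖⁻¹) • 0) (by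
    simp [norm_smul, hy0.ne'])
  simp only [smul_eq_mul, sub_zero] at h1
  have h3 := mul_le_mul_of_nonneg_left (h2.trans h1) hy0.le
  have h4 : ‖y‖ * (‖y‖⁻¹ * h y + (1 - ‖y‖⁻¹) * h 0 - ‖y‖⁻¹ * (1 - ‖y‖⁻¹) * (m / 2 * ‖y‖ ^ 2))
      = h y + (‖y‖ - 1) * h 0 - m / 2 * ‖y‖ * (‖y‖ - 1) := by
    field_simp
  rw [h4] at h3
  have h5 : h 0 - B ≤ m / 2 * (‖y‖ - 1) := by
    have := mul_le_mul_of_nonneg_left (sub_le_sub_right hy 1) (by positivity : 0 ≤ m / 2)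
    calc h 0 - B = m / 2 * (1 + 2 / m * (h 0 - B) - 1) := by field_simp; ring
      _ ≤ _ := this
  nlinarith [mul_le_mul_of_nonneg_left h5 hy0.le]

theorem StrongConvexOn.sub_inner {m : ℝ} {h : E → ℝ} (hh : StrongConvexOn univ m h) (u : E) :
    StrongConvexOn univ m fun z => h z - inner ℝ z u := by
  refine ⟨convex_univ, fun x _ y _ a b ha hb hab => ?_⟩
  have := hh.2 (mem_univ x) (mem_univ y) ha hb hab
  simp only [smul_eq_mul, inner_add_left, real_inner_smul_left] at this ⊢
  linarith

/-! ### Convex conjugates -/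

theorem convexConj_eq_of_forall_le {h : E → ℝ} {u z : E}
    (hz : ∀ y, inner ℝ y u - h y ≤ inner ℝ z u - h z) :
    convexConj h u = inner ℝ z u - h z :=
  le_antisymm (ciSup_le hz) (le_ciSup ⟨_, by rintro _ ⟨y, rfl⟩; exact hz y⟩ z)

/-- The supremum defining the conjugate of a strongly convex function is attained, with quadratic
growth. -/
theorem StrongConvexOn.exists_convexConj_eq [FiniteDimensional ℝ E] {m : ℝ} (hm : 0 < m)
    {h : E → ℝ} (hh : StrongConvexOn univ m h) (u : E) :
    ∃ z, convexConj h u = inner ℝ z u - h z ∧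
      ∀ y, inner ℝ y u - h y + m / 2 * ‖y - z‖ ^ 2 ≤ convexConj h u := by
  obtain ⟨z, hz⟩ := (hh.sub_inner u).exists_forall_le hm
  have h1 := convexConj_eq_of_forall_le (h := h) (u := u) (z := z)
    fun y => by have := hz y; linarith
  refine ⟨z, h1, fun y => ?_⟩
  have := (hh.sub_inner u).add_norm_sq_le_of_forall_le hz y
  linarith

theorem StrongConvexOn.fenchel_young [FiniteDimensional ℝ E] {m : ℝ} (hm : 0 < m)
    {h : E → ℝ} (hh : StrongConvexOn univ m h) (y u : E) :
    inner ℝ y u - h y ≤ convexConj h u := by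
  obtain ⟨z, -, hz⟩ := hh.exists_convexConj_eq hm u
  have : 0 ≤ m / 2 * ‖y - z‖ ^ 2 := by positivity
  linarith [hz y]

/-- The conjugate of a `1`-strongly convex function is differentiable and `1`-smooth, and its
gradient attains the supremum. -/
theorem StrongConvexOn.convexConj_smooth [FiniteDimensional ℝ E] [CompleteSpace E]
    {h : E → ℝ} (hh : StrongConvexOn univ 1 h) (u : E) :
    HasGradientAt (convexConj h) (gradient (convexConj h) u) u ∧
    convexConj h u = inner ℝ (gradient (convexConj h) u) u - h (gradient (convexConj h) u) ∧
    (∀ v, convexConj h u + inner ℝ (gradient (convexConj h) u) (v - u) ≤ convexConj h v) ∧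
    (∀ v, convexConj h v ≤ convexConj h u + inner ℝ (gradient (convexConj h) u) (v - u)
      + 1 / 2 * ‖v - u‖ ^ 2) := by
  obtain ⟨z, hz, hgr⟩ := hh.exists_convexConj_eq one_pos u
  have hlow : ∀ v, convexConj h u + inner ℝ z (v - u) ≤ convexConj h v := fun v => by
    have := hh.fenchel_young one_pos z v
    rw [inner_sub_right]
    linarith
  have hup : ∀ v, convexConj h v ≤ convexConj h u + inner ℝ z (v - u)
      + 1 / 2 * ‖v - u‖ ^ 2 := fun v => by
    obtain ⟨y, hy, -⟩ := hh.exists_convexConj_eq one_pos v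
    -- Quadratic growth at `u` supplies `-½‖y - z‖²`, which absorbs `⟪y - z, v - u⟫` up to `½‖v -
    -- u‖²`.
    have h1 := hgr y
    have h2 : inner ℝ y v = inner ℝ y u + inner ℝ z (v - u) + inner ℝ (y - z) (v - u) := by
      simp only [inner_sub_left, inner_sub_right]; ring
    have h3 := real_inner_le_norm (y - z) (v - u)
    nlinarith [sq_nonneg (‖y - z‖ - ‖v - u‖)]
  -- Squeezed between an affine function and the same function plus `½‖v - u‖²`, the conjugate is
  -- differentiable.
  have hgrad : HasGradientAt (convexConj h) z u := by
    rw [hasGradientAt_iff_isLittleO]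
    refine Asymptotics.IsBigO.trans_isLittleO (g := fun v => ‖v - u‖ ^ 2) ?_ ?_
    · refine Asymptotics.IsBigO.of_bound 1 (Filter.Eventually.of_forall fun v => ?_)
      rw [Real.norm_eq_abs, Real.norm_eq_abs, abs_of_nonneg (sq_nonneg ‖v - u‖), abs_le]
      have := hlow v
      have := hup v
      have := sq_nonneg ‖v - u‖
      constructor <;> linarith
    · have := (Asymptotics.isLittleO_pow_sub_sub u one_lt_two)
      exact this
  rw [hgrad.gradient]
  exact ⟨hgrad, hz, hlow, hup⟩

end StrongConvex

/-! ### Conjugates of smooth functions of one variable -/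

/-- On the segment, the derivative in `t` grows by at most `K t (b - a)²`, which is the growth of
the derivative of the quadratic majorant. -/
theorem IsSmoothFun.le_add {K : ℝ} {h : ℝ → ℝ} (hh : IsSmoothFun K h) (a b : ℝ) :
    h b ≤ h a + deriv h a * (b - a) + K / 2 * (b - a) ^ 2 := by
  have hr : ∀ t : ℝ, HasDerivAt (fun t => h (a + t * (b - a)))
      (deriv h (a + t * (b - a)) * (1 * (b - a))) t := fun t =>
    (hh.1 _).hasDerivAt.comp t (((hasDerivAt_id t).mul_const (b - a)).const_add a)
  have hB : ∀ t : ℝ, HasDerivAt (fun t => h a + t * (deriv h a * (b - a))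
      + t ^ 2 * (K / 2 * (b - a) ^ 2))
      (1 * (deriv h a * (b - a)) + 2 * t * (K / 2 * (b - a) ^ 2)) t := fun t => by
    have h2 := (hasDerivAt_pow 2 t).mul_const (K / 2 * (b - a) ^ 2)
    simp only [Nat.cast_ofNat, Nat.add_one_sub_one, pow_one] at h2
    exact (((hasDerivAt_id t).mul_const (deriv h a * (b - a))).const_add (h a)).add h2
  have := image_le_of_deriv_right_le_deriv_boundary (a := 0) (b := 1)
    (fun t _ => (hr t).continuousAt.continuousWithinAt)
    (fun t _ => (hr t).hasDerivWithinAt) (by simp)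
    (fun t _ => (hB t).continuousAt.continuousWithinAt)
    (fun t _ => (hB t).hasDerivWithinAt) (fun t ht => ?_) (right_mem_Icc.2 zero_le_one)
  · simp only [one_mul, add_sub_cancel, one_pow] at this
    linarith
  · have h1 := hh.2 (a + t * (b - a)) a
    rw [add_sub_cancel_left, abs_mul, abs_of_nonneg ht.1] at h1
    have h2 : (deriv h (a + t * (b - a)) - deriv h a) * (b - a)
        ≤ K * (t * |b - a|) * |b - a| :=
      (le_abs_self _).trans ((abs_mul _ _).trans_le
        (mul_le_mul_of_nonneg_right h1 (abs_nonneg _)))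
    have h3 : K * (t * |b - a|) * |b - a| = K * t * ((b - a) * (b - a)) := by
      rw [← abs_mul_abs_self (b - a)]; ring
    rw [h3] at h2
    linarith

/-- At a minimizer `z`, both estimates bound `h (z + 1) - h z`, by `m / 2` from below and `K / 2`
from above. This yields `gam ≤ eta`. -/
theorem IsSmoothFun.strongConvexOn_le {K m : ℝ} {h : ℝ → ℝ} (hh : IsSmoothFun K h)
    (hm : 0 < m) (hc : StrongConvexOn univ m h) : m ≤ K := by
  obtain ⟨z, hz⟩ := hc.exists_forall_le hm
  have h1 := hc.add_norm_sq_le_of_forall_le hz (z + 1)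
  have h2 := hh.le_add z (z + 1)
  have h3 : deriv h z = 0 := IsLocalMin.deriv_eq_zero (Filter.Eventually.of_forall hz)
  simp [h3] at h1 h2
  linarith

/-- The conjugate of a `1/γ`-smooth function has a quadratic minorant with curvature `γ` at every
point. -/
theorem IsSmoothFun.convexConj_minorant {γ m : ℝ} (hγ : 0 < γ) {h : ℝ → ℝ}
    (hh : IsSmoothFun (1 / γ) h) (hm : 0 < m) (hc : StrongConvexOn univ m h) (s : ℝ) :
    ∃ t, ∀ s', convexConj h s + t * (s' - s) + γ / 2 * (s' - s) ^ 2 ≤ convexConj h s' := by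
  obtain ⟨t, ht, hgr⟩ := hc.exists_convexConj_eq hm s
  have hmin : ∀ y, h t - t * s ≤ h y - y * s := fun y => by
    have := hgr y
    have h0 : 0 ≤ m / 2 * ‖y - t‖ ^ 2 := by positivity
    rw [ht] at this
    simp only [RCLike.inner_apply, conj_trivial] at this
    linarith
  have hd : deriv h t = s := by
    have h1 : HasDerivAt (fun y => h y - y * s) (deriv h t - 1 * s) t :=
      (hh.1 t).hasDerivAt.sub ((hasDerivAt_id t).mul_const s)
    have := IsLocalMin.hasDerivAt_eq_zero (Filter.Eventually.of_forall hmin) h1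
    linarith
  refine ⟨t, fun s' => ?_⟩
  -- This test point maximizes `y * s'` minus the quadratic majorant of `h` at `t`.
  have h1 := hc.fenchel_young hm (t + γ * (s' - s)) s'
  have h2 := hh.le_add t (t + γ * (s' - s))
  simp only [RCLike.inner_apply, conj_trivial] at ht h1
  rw [hd] at h2
  have h3 : 1 / γ / 2 * (t + γ * (s' - s) - t) ^ 2 = γ / 2 * (s' - s) ^ 2 := by
    field_simp; ring
  rw [h3] at h2
  rw [ht]
  nlinarith

/-- Equality case of the Fenchel-Young inequality. -/
theorem convexConj_deriv {h : ℝ → ℝ} (hd : Differentiable ℝ h) (hc : ConvexOn ℝ univ h) (t : ℝ) :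
    convexConj h (deriv h t) = t * deriv h t - h t := by
  rw [convexConj_eq_of_forall_le (z := t)]
  · simp [mul_comm]
  · intro y
    simp only [RCLike.inner_apply, conj_trivial]
    rcases lt_trichotomy y t with hy | rfl | hy
    · have := hc.slope_le_of_hasDerivAt (mem_univ y) (mem_univ t) hy (hd t).hasDerivAt
      rw [slope_def_field, div_le_iff₀ (sub_pos.2 hy)] at this
      linarith
    · rfl
    · have := hc.le_slope_of_hasDerivAt (mem_univ t) (mem_univ y) hy (hd t).hasDerivAt
      rw [slope_def_field, le_div_iff₀ (sub_pos.2 hy)] at this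
      linarith

/-! ### One step of the accelerated method with constant step size

With `γ₀ = μ` the parameters are constant: `γ_k = μ` and `α_k = β_k = √μ / n`. The iterates are
`x = n α z + (1 - n α) p`, where `p` is a running average of the past points `z`. -/

theorem apcgAlpha_self {n : ℕ} (hn : 0 < n) {μ : ℝ} (hμ : 0 < μ) : apcgAlpha n μ μ = √μ / n := by
  symm
  rw [← apcgAlpha_unique hn μ hμ]
  have hn' : (0 : ℝ) < n := by exact_mod_cast hn
  refine ⟨by positivity, ?_⟩
  rw [div_pow, Real.sq_sqrt hμ.le]
  field_simp
  ring

theorem apcgGamma_self (n : ℕ) (μ : ℝ) (k : ℕ) : apcgGamma n μ μ k = μ := by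
  induction k with
  | zero => rfl
  | succ k ih => rw [apcgGamma, ih]; ring

section Step

variable {n : ℕ} (f : EuclideanSpace ℝ (Fin n) → ℝ) (Ψ : Fin n → ℝ → ℝ) (L : Fin n → ℝ)
  (α : ℝ)

/-- The iterate `x` determined by the state `(p, z)`. -/
noncomputable def apcgPoint (s : EuclideanSpace ℝ (Fin n) × EuclideanSpace ℝ (Fin n)) :
    EuclideanSpace ℝ (Fin n) :=
  (n * α) • s.2 + (1 - n * α) • s.1

/-- The extrapolated point `y` determined by the state `(p, z)`. -/
noncomputable def apcgExtrap (s : EuclideanSpace ℝ (Fin n) × EuclideanSpace ℝ (Fin n)) :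
    EuclideanSpace ℝ (Fin n) :=
  (1 / (1 + α)) • (α • s.2 + apcgPoint α s)

/-- The center of the proximal step determined by the state `(p, z)`. -/
noncomputable def apcgCenter (s : EuclideanSpace ℝ (Fin n) × EuclideanSpace ℝ (Fin n)) :
    EuclideanSpace ℝ (Fin n) :=
  (1 - α) • s.2 + α • apcgExtrap α s

/-- The next running average `p`. -/
noncomputable def apcgAverage (s : EuclideanSpace ℝ (Fin n) × EuclideanSpace ℝ (Fin n)) :
    EuclideanSpace ℝ (Fin n) :=
  (1 - α * (1 + n * α) / (1 + α)) • s.1 + (α * (1 + n * α) / (1 + α)) • s.2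

/-- One step of the method on states `(p, z)`. -/
noncomputable def apcgStep (s : EuclideanSpace ℝ (Fin n) × EuclideanSpace ℝ (Fin n)) (i : Fin n) :
    EuclideanSpace ℝ (Fin n) × EuclideanSpace ℝ (Fin n) :=
  (apcgAverage α s, argMin fun v : EuclideanSpace ℝ (Fin n) =>
    n * α / 2 * weightedNormSq L (v - apcgCenter α s)
      + gradient f (apcgExtrap α s) i * v i + Ψ i (v i))

/-- The Lyapunov function of the method. -/
noncomputable def apcgPotential (μ : ℝ) (xs : EuclideanSpace ℝ (Fin n))
    (s : EuclideanSpace ℝ (Fin n) × EuclideanSpace ℝ (Fin n)) : ℝ :=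
  f (apcgPoint α s) + n * α * ∑ j, Ψ j (s.2 j) + (1 - n * α) * ∑ j, Ψ j (s.1 j)
    - (f xs + ∑ j, Ψ j (xs j)) + μ / 2 * weightedNormSq L (s.2 - xs)

variable {f Ψ L α}

theorem sum_update_coord (F : Fin n → ℝ → ℝ) (v : EuclideanSpace ℝ (Fin n)) (i : Fin n) (t : ℝ) :
    ∑ j, F j ((v + EuclideanSpace.single i t) j)
      = ∑ j, F j (v j) + (F i (v i + t) - F i (v i)) := by
  rw [← sub_eq_iff_eq_add', ← Finset.sum_sub_distrib, Finset.sum_eq_single i]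
  · simp
  · intro j _ hj
    simp [hj]
  · simp

/-- The proximal step changes a single coordinate, by the minimizer of a problem in one variable. -/
theorem exists_argMin_prox_eq (hL : ∀ i, 0 < L i) {c : ℝ} (hc : 0 < c)
    (hΨ : ∀ i, ConvexOn ℝ univ (Ψ i)) (w : EuclideanSpace ℝ (Fin n)) (a : ℝ) (i : Fin n) :
    ∃ h : ℝ, (argMin fun v : EuclideanSpace ℝ (Fin n) =>
        c / 2 * weightedNormSq L (v - w) + a * v i + Ψ i (v i))
          = w + EuclideanSpace.single i h ∧
      ∀ t, c * L i / 2 * h ^ 2 + a * (w i + h) + Ψ i (w i + h)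
          + c * L i / 2 * (t - (w i + h)) ^ 2
        ≤ c * L i / 2 * (t - w i) ^ 2 + a * t + Ψ i t := by
  have hcL : 0 < c * L i := mul_pos hc (hL i)
  have hsc : StrongConvexOn univ (c * L i)
      fun t : ℝ => c * L i / 2 * (t - w i) ^ 2 + a * t + Ψ i t := by
    refine ⟨convex_univ, fun x _ y _ p q hp hq hpq => ?_⟩
    have := (hΨ i).2 (mem_univ x) (mem_univ y) hp hq hpq
    simp only [smul_eq_mul, Real.norm_eq_abs, sq_abs] at this ⊢
    obtain rfl : q = 1 - p := by linarith
    linarith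
  obtain ⟨t₀, ht₀⟩ := hsc.exists_forall_le hcL
  have hgr := hsc.add_norm_sq_le_of_forall_le ht₀
  refine ⟨t₀ - w i, ?_, fun t => ?_⟩
  -- Moving any coordinate other than `i` away from `w` only adds to the cost.
  · have hlow : ∀ v : EuclideanSpace ℝ (Fin n),
        L i * (v i - w i) ^ 2 ≤ weightedNormSq L (v - w) := fun v => by
      have := Finset.single_le_sum (f := fun j => L j * (v - w) j ^ 2)
        (fun j _ => mul_nonneg (hL j).le (sq_nonneg _)) (Finset.mem_univ i)
      simpa [weightedNormSq] using this
    have hval : weightedNormSq L (w + EuclideanSpace.single i (t₀ - w i) - w)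
        = L i * (t₀ - w i) ^ 2 := by
      rw [add_sub_cancel_left, weightedNormSq, Finset.sum_eq_single i]
      · simp
      · intro j _ hj
        simp [hj]
      · simp
    have hmin : ∀ v : EuclideanSpace ℝ (Fin n),
        c / 2 * weightedNormSq L (w + EuclideanSpace.single i (t₀ - w i) - w)
          + a * (w + EuclideanSpace.single i (t₀ - w i)) i
          + Ψ i ((w + EuclideanSpace.single i (t₀ - w i)) i)
        ≤ c / 2 * weightedNormSq L (v - w) + a * v i + Ψ i (v i) := fun v => by
      have h1 := ht₀ (v i)
      have h2 := mul_le_mul_of_nonneg_left (hlow v) (by positivity : 0 ≤ c / 2)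
      rw [hval]
      simp only [PiLp.add_apply, PiLp.single_apply, if_true, add_sub_cancel]
      linarith
    -- `argMin` picks an unspecified minimizer, so uniqueness is needed: quadratic growth pins
    -- coordinate `i` to `t₀`, and positivity of the `L j` pins the others to `w`.
    have hspec := Classical.epsilon_spec (p := fun x : EuclideanSpace ℝ (Fin n) =>
      ∀ x' : EuclideanSpace ℝ (Fin n),
        c / 2 * weightedNormSq L (x - w) + a * x i + Ψ i (x i)
          ≤ c / 2 * weightedNormSq L (x' - w) + a * x' i + Ψ i (x' i)) ⟨_, hmin⟩
    change (Classical.epsilon fun x : EuclideanSpace ℝ (Fin n) =>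
      ∀ x' : EuclideanSpace ℝ (Fin n),
        c / 2 * weightedNormSq L (x - w) + a * x i + Ψ i (x i)
          ≤ c / 2 * weightedNormSq L (x' - w) + a * x' i + Ψ i (x' i)) = _
    generalize (Classical.epsilon fun x : EuclideanSpace ℝ (Fin n) =>
      ∀ x' : EuclideanSpace ℝ (Fin n),
        c / 2 * weightedNormSq L (x - w) + a * x i + Ψ i (x i)
          ≤ c / 2 * weightedNormSq L (x' - w) + a * x' i + Ψ i (x' i)) = v at hspec
    have h1 := hspec (w + EuclideanSpace.single i (t₀ - w i))
    rw [hval] at h1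
    simp only [PiLp.add_apply, PiLp.single_apply, if_true, add_sub_cancel] at h1
    have h2 := hgr (v i)
    have h3 := mul_le_mul_of_nonneg_left (hlow v) (by positivity : 0 ≤ c / 2)
    rw [Real.norm_eq_abs, sq_abs] at h2
    have hvi : v i = t₀ := by
      have : c * L i / 2 * (v i - t₀) ^ 2 ≤ 0 := by linarith
      have h5 : (v i - t₀) ^ 2 ≤ 0 := by
        by_contra! h
        have := mul_pos (half_pos hcL) h
        linarith
      have := pow_eq_zero_iff two_ne_zero |>.1 (le_antisymm h5 (sq_nonneg _))
      linarith
    rw [hvi] at h1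
    have h6 : weightedNormSq L (v - w) ≤ L i * (t₀ - w i) ^ 2 := by
      have : c / 2 * weightedNormSq L (v - w) ≤ c / 2 * (L i * (t₀ - w i) ^ 2) := by linarith
      exact le_of_mul_le_mul_left this (half_pos hc)
    ext j
    by_cases hj : j = i
    · subst hj; simp [hvi]
    · have h7 : L i * (v i - w i) ^ 2 + L j * (v j - w j) ^ 2 ≤ weightedNormSq L (v - w) := by
        have := Finset.sum_le_univ_sum_of_nonneg (s := {i, j})
          (f := fun j => L j * (v - w) j ^ 2) (fun j => mul_nonneg (hL j).le (sq_nonneg _))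
        rw [Finset.sum_pair (Ne.symm hj)] at this
        simpa [weightedNormSq] using this
      rw [hvi] at h7
      have h8 : L j * (v j - w j) ^ 2 ≤ 0 := by linarith
      have h9 : (v j - w j) ^ 2 ≤ 0 := by
        by_contra! h
        have := mul_pos (hL j) h
        linarith
      have := pow_eq_zero_iff two_ne_zero |>.1 (le_antisymm h9 (sq_nonneg _))
      simp [hj]
      linarith
  · have := hgr t
    rw [Real.norm_eq_abs, sq_abs] at this
    rw [add_sub_cancel]
    linarith

/-- For `nα ≤ 1` these weights are those of a convex combination, so `Ψ` at the center is controlled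
by `Ψ(z)` and `Ψ(p)`. -/
theorem apcgCenter_eq_combo (hα : 0 < α) (s : EuclideanSpace ℝ (Fin n) × EuclideanSpace ℝ (Fin n)) :
    apcgCenter α s = (1 - α * (1 - n * α) / (1 + α)) • s.2
      + (α * (1 - n * α) / (1 + α)) • s.1 := by
  have : (1 : ℝ) + α ≠ 0 := by positivity
  simp only [apcgCenter, apcgExtrap, apcgPoint]
  ext j
  simp only [PiLp.add_apply, PiLp.smul_apply, smul_eq_mul]
  field_simp
  ring

/-- Because `v` will differ from the center in one coordinate only, the new `x` differs from `y` in
that coordinate only, and coordinate smoothness of `f` applies. -/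
theorem apcgPoint_step (hα : 0 < α) (s : EuclideanSpace ℝ (Fin n) × EuclideanSpace ℝ (Fin n))
    (v : EuclideanSpace ℝ (Fin n)) :
    apcgPoint α (apcgAverage α s, v) = apcgExtrap α s + (n * α) • (v - apcgCenter α s) := by
  have : (1 : ℝ) + α ≠ 0 := by positivity
  simp only [apcgCenter, apcgExtrap, apcgPoint, apcgAverage]
  ext j
  simp only [PiLp.add_apply, PiLp.sub_apply, PiLp.smul_apply, smul_eq_mul]
  field_simp
  ring

/-- The potential after a step in coordinate `i`. -/
theorem apcgPotential_step_le {μ : ℝ} (hα : 0 < α) (hαμ : ((n : ℝ) * α) ^ 2 = μ)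
    (hL : ∀ i, 0 < L i) (hΨ : ∀ i, ConvexOn ℝ univ (Ψ i))
    (hup : ∀ y i t, f (y + EuclideanSpace.single i t) ≤ f y + t * gradient f y i + L i / 2 * t ^ 2)
    (xs : EuclideanSpace ℝ (Fin n)) (s : EuclideanSpace ℝ (Fin n) × EuclideanSpace ℝ (Fin n))
    (i : Fin n) :
    apcgPotential f Ψ L α μ xs (apcgStep f Ψ L α s i)
      ≤ f (apcgExtrap α s)
        + n * α * (gradient f (apcgExtrap α s) i * (xs i - apcgCenter α s i))
        + n * α * (Ψ i (xs i) - Ψ i (apcgCenter α s i))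
        + n * α * ∑ j, Ψ j (apcgCenter α s j)
        + (1 - n * α) * ∑ j, Ψ j (apcgAverage α s j)
        - (f xs + ∑ j, Ψ j (xs j)) + μ / 2 * weightedNormSq L (apcgCenter α s - xs) := by
  have hn : (0 : ℝ) < n := by exact_mod_cast i.pos
  have hnα : 0 < n * α := by positivity
  obtain ⟨h, hh, hopt⟩ := exists_argMin_prox_eq hL hnα hΨ (apcgCenter α s)
    (gradient f (apcgExtrap α s) i) i
  have hstep : apcgStep f Ψ L α s i
      = (apcgAverage α s, apcgCenter α s + EuclideanSpace.single i h) := by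
    rw [apcgStep, hh]
  have hx : apcgPoint α (apcgAverage α s, apcgCenter α s + EuclideanSpace.single i h)
      = apcgExtrap α s + EuclideanSpace.single i (n * α * h) := by
    rw [apcgPoint_step hα, add_sub_cancel_left]
    congr 1
    ext j
    by_cases hj : j = i <;> simp [hj]
  have hw : weightedNormSq L (apcgCenter α s + EuclideanSpace.single i h - xs)
      = weightedNormSq L (apcgCenter α s - xs)
        + (L i * (apcgCenter α s i + h - xs i) ^ 2 - L i * (apcgCenter α s i - xs i) ^ 2) := by
    have := sum_update_coord (fun j t => L j * (t - xs j) ^ 2) (apcgCenter α s) i h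
    simpa [weightedNormSq] using this
  rw [hstep, apcgPotential, hx, hw]
  simp only []
  rw [sum_update_coord Ψ]
  have h1 := hup (apcgExtrap α s) i (n * α * h)
  -- Multiplied by `nα`, the prox inequality has curvature `(nα)² L_i = μ L_i`: it matches the
  -- smoothness error in `h1` and the distance terms of the potential.
  have h2 := mul_le_mul_of_nonneg_left (hopt (xs i)) hnα.le
  subst hαμ
  linarith

theorem weightedNormSq_combo_le (hL : ∀ i, 0 < L i) {t : ℝ} (h0 : 0 ≤ t) (h1 : t ≤ 1)
    (u v : EuclideanSpace ℝ (Fin n)) :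
    weightedNormSq L ((1 - t) • u + t • v)
      ≤ (1 - t) * weightedNormSq L u + t * weightedNormSq L v := by
  simp only [weightedNormSq, Finset.mul_sum, ← Finset.sum_add_distrib]
  refine Finset.sum_le_sum fun j _ => ?_
  simp only [PiLp.add_apply, PiLp.smul_apply, smul_eq_mul]
  have := mul_nonneg (hL j).le (mul_nonneg (mul_nonneg h0 (sub_nonneg.2 h1)) (sq_nonneg (u j - v j)))
  linarith

theorem sum_combo_le (hΨ : ∀ i, ConvexOn ℝ univ (Ψ i)) {t : ℝ} (h0 : 0 ≤ t) (h1 : t ≤ 1)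
    (u v : EuclideanSpace ℝ (Fin n)) :
    ∑ j, Ψ j (((1 - t) • u + t • v) j) ≤ (1 - t) * ∑ j, Ψ j (u j) + t * ∑ j, Ψ j (v j) := by
  simp only [Finset.mul_sum, ← Finset.sum_add_distrib]
  exact Finset.sum_le_sum fun j _ =>
    (hΨ j).2 (mem_univ (u j)) (mem_univ (v j)) (sub_nonneg.2 h1) h0 (by ring)

/-- The potential decreases in expectation by the factor `1 - α` in every step. -/
theorem average_apcgPotential_step_le {μ : ℝ} (hn : 0 < n) (hα : 0 < α) (hnα1 : n * α ≤ 1)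
    (hαμ : ((n : ℝ) * α) ^ 2 = μ)
    (hL : ∀ i, 0 < L i) (hΨ : ∀ i, ConvexOn ℝ univ (Ψ i))
    (hup : ∀ y i t, f (y + EuclideanSpace.single i t) ≤ f y + t * gradient f y i + L i / 2 * t ^ 2)
    (hlow : ∀ y v, f y + inner ℝ (gradient f y) (v - y) + μ / 2 * weightedNormSq L (v - y) ≤ f v)
    (xs : EuclideanSpace ℝ (Fin n)) (s : EuclideanSpace ℝ (Fin n) × EuclideanSpace ℝ (Fin n)) :
    1 / n * ∑ i, apcgPotential f Ψ L α μ xs (apcgStep f Ψ L α s i)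
      ≤ (1 - α) * apcgPotential f Ψ L α μ xs s := by
  have hn' : (1 : ℝ) ≤ n := by exact_mod_cast hn
  have hα1 : α ≤ 1 := by nlinarith
  have hμ : 0 ≤ μ := hαμ ▸ sq_nonneg _
  have hden : 0 < 1 + α := by positivity
  set x := apcgPoint α s with hx
  set y := apcgExtrap α s with hy
  set zt := apcgCenter α s with hzt
  set G := gradient f y with hG
  have havg : 1 / n * ∑ i, apcgPotential f Ψ L α μ xs (apcgStep f Ψ L α s i)
      ≤ f y + α * inner ℝ G (xs - zt) + α * (∑ j, Ψ j (xs j) - ∑ j, Ψ j (zt j))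
        + n * α * ∑ j, Ψ j (zt j) + (1 - n * α) * ∑ j, Ψ j (apcgAverage α s j)
        - (f xs + ∑ j, Ψ j (xs j)) + μ / 2 * weightedNormSq L (zt - xs) := by
    have := Finset.sum_le_sum fun i (_ : i ∈ Finset.univ) =>
      apcgPotential_step_le hα hαμ hL hΨ hup xs s i
    refine (mul_le_mul_of_nonneg_left this (by positivity)).trans_eq ?_
    have hin : inner ℝ G (xs - zt) = ∑ i, G i * (xs i - zt i) := by
      simp [PiLp.inner_apply, mul_comm]
    rw [hin]
    simp only [Finset.sum_add_distrib, Finset.sum_sub_distrib, ← Finset.mul_sum, Finset.sum_const,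
      Finset.card_univ, Fintype.card_fin, nsmul_eq_mul]
    field_simp
    ring
  have hτ1 : α * (1 + n * α) / (1 + α) ≤ 1 := by
    rw [div_le_one hden]; nlinarith
  have hc0 : 0 ≤ α * (1 - n * α) / (1 + α) :=
    div_nonneg (mul_nonneg hα.le (by linarith)) hden.le
  have hc1 : α * (1 - n * α) / (1 + α) ≤ 1 := by
    rw [div_le_one hden]; nlinarith
  have hΨp := sum_combo_le hΨ (by positivity) hτ1 s.1 s.2
  have hΨz := sum_combo_le hΨ hc0 hc1 s.2 s.1
  rw [← apcgCenter_eq_combo hα s, ← hzt] at hΨz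
  change ∑ j, Ψ j (apcgAverage α s j) ≤ _ at hΨp
  -- The weights of `Ψ(z)` and `Ψ(p)` on the two sides agree exactly; this is what the coefficients
  -- in `apcgAverage` achieve.
  have hΨtot : (n - 1) * α * ∑ j, Ψ j (zt j) + (1 - n * α) * ∑ j, Ψ j (apcgAverage α s j)
      ≤ (1 - α) * (n * α * ∑ j, Ψ j (s.2 j) + (1 - n * α) * ∑ j, Ψ j (s.1 j)) := by
    have h1 := mul_le_mul_of_nonneg_left hΨz
      (mul_nonneg (sub_nonneg.2 hn') hα.le : 0 ≤ ((n : ℝ) - 1) * α)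
    have h2 := mul_le_mul_of_nonneg_left hΨp (sub_nonneg.2 hnα1)
    refine (add_le_add h1 h2).trans_eq ?_
    field_simp
    ring
  have hdist : weightedNormSq L (zt - xs)
      ≤ (1 - α) * weightedNormSq L (s.2 - xs) + α * weightedNormSq L (xs - y) := by
    have h1 := weightedNormSq_combo_le hL hα.le hα1 (s.2 - xs) (y - xs)
    have h2 : (1 - α) • (s.2 - xs) + α • (y - xs) = zt - xs := by
      rw [hzt, apcgCenter]; module
    have h3 : weightedNormSq L (y - xs) = weightedNormSq L (xs - y) := by
      simp only [weightedNormSq, PiLp.sub_apply]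
      exact Finset.sum_congr rfl fun j _ => by ring
    rwa [h2, h3] at h1
  -- The choice of `y` makes the linear terms of the lower bounds of `f` at `x` (weight `1 - α`) and
  -- at `xs` (weight `α`) combine into the one in `havg`.
  have hinner : (1 - α) * inner ℝ G (x - y) + α * inner ℝ G (xs - y)
      = α * inner ℝ G (xs - zt) := by
    have h1 : (1 + α) • y = α • s.2 + x := by
      rw [hy, apcgExtrap, smul_smul, mul_one_div_cancel hden.ne', one_smul]
    have h2 : (1 - α) • (x - y) + α • (xs - y) = α • (xs - zt) := by
      obtain h3 : x = (1 + α) • y - α • s.2 := by rw [h1]; module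
      rw [h3, hzt, apcgCenter]
      module
    simpa only [inner_add_right, inner_smul_right] using congrArg (inner ℝ G) h2
  have hfx := mul_le_mul_of_nonneg_left (hlow y x) (sub_nonneg.2 hα1)
  have hfs := mul_le_mul_of_nonneg_left (hlow y xs) hα.le
  have hpos : 0 ≤ (1 - α) * (μ / 2 * weightedNormSq L (x - y)) :=
    mul_nonneg (sub_nonneg.2 hα1) (mul_nonneg (by positivity)
      (Finset.sum_nonneg fun j _ => mul_nonneg (hL j).le (sq_nonneg _)))
  have hdist' := mul_le_mul_of_nonneg_left hdist (by positivity : 0 ≤ μ / 2)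
  refine havg.trans ?_
  rw [apcgPotential, ← hx]
  linarith

/-- The potential dominates the objective gap. -/
theorem le_apcgPotential {μ : ℝ} (hμ : 0 ≤ μ) (hα : 0 ≤ α) (hnα1 : n * α ≤ 1)
    (hL : ∀ i, 0 < L i) (hΨ : ∀ i, ConvexOn ℝ univ (Ψ i))
    (xs : EuclideanSpace ℝ (Fin n)) (s : EuclideanSpace ℝ (Fin n) × EuclideanSpace ℝ (Fin n)) :
    f (apcgPoint α s) + ∑ j, Ψ j (apcgPoint α s j) - (f xs + ∑ j, Ψ j (xs j))
      ≤ apcgPotential f Ψ L α μ xs s := by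
  have h1 := sum_combo_le hΨ (by positivity) hnα1 s.1 s.2
  rw [add_comm ((1 - n * α) • s.1)] at h1
  change ∑ j, Ψ j (apcgPoint α s j) ≤ _ at h1
  have h2 : 0 ≤ μ / 2 * weightedNormSq L (s.2 - xs) := mul_nonneg (by positivity)
    (Finset.sum_nonneg fun j _ => mul_nonneg (hL j).le (sq_nonneg _))
  rw [apcgPotential]
  linarith

end Step

/-! ### Iterating a random map -/

/-- Iteration of a map that takes a parameter from a given sequence in every step. -/
def iterateWith {S ι : Type*} (T : S → ι → S) (s₀ : S) (i : ℕ → ι) : ℕ → S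
  | 0 => s₀
  | k + 1 => T (iterateWith T s₀ i k) (i k)

/-- Starting from `p = z = x₀`, the two recursions agree because `μ / n = nα²` merges the last two
terms of the `x` update into `nα (z₁ - center)`. -/
theorem apcg_eq_iterateWith {n : ℕ} (hn : 0 < n) (f : EuclideanSpace ℝ (Fin n) → ℝ)
    (Ψ : Fin n → ℝ → ℝ) (L : Fin n → ℝ) {μ : ℝ} (hμ : 0 < μ) (x₀ : EuclideanSpace ℝ (Fin n))
    (i : ℕ → Fin n) (k : ℕ) :
    apcg f Ψ L μ μ x₀ i k
      = (apcgPoint (√μ / n) (iterateWith (apcgStep f Ψ L (√μ / n)) (x₀, x₀) i k),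
        (iterateWith (apcgStep f Ψ L (√μ / n)) (x₀, x₀) i k).2) := by
  have hn' : (0 : ℝ) < n := by exact_mod_cast hn
  induction k with
  | zero =>
    simp only [apcg, iterateWith, apcgPoint]
    congr 1
    module
  | succ k ih =>
    simp only [apcg, ih, iterateWith, apcgGamma_self, apcgAlpha_self hn hμ]
    set s := iterateWith (apcgStep f Ψ L (√μ / n)) (x₀, x₀) i k
    have hα : 0 < √μ / n := by positivity
    have hαμ : μ = (n * (√μ / n)) ^ 2 := by
      rw [mul_div_cancel₀ _ hn'.ne', Real.sq_sqrt hμ.le]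
    set α := √μ / n
    have hden : (1 : ℝ) + α ≠ 0 := by positivity
    have hy : (1 / (α * μ + μ)) • ((α * μ) • s.2 + μ • apcgPoint α s) = apcgExtrap α s := by
      have : α * μ + μ ≠ 0 := by positivity
      ext j
      simp only [apcgExtrap, PiLp.add_apply, PiLp.smul_apply, smul_eq_mul]
      have h2 : α * μ + μ = μ * (1 + α) := by ring
      rw [h2]
      field_simp
    have hβ : α * μ / μ = α := by field_simp
    rw [hy, hβ]
    have hc : ∀ v : EuclideanSpace ℝ (Fin n),
        v - (1 - α) • s.2 - α • apcgExtrap α s = v - apcgCenter α s := fun v => by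
      rw [apcgCenter]; module
    simp only [hc]
    change (_, (apcgStep f Ψ L α s (i k)).2) = _
    congr 1
    change _ = apcgPoint α (apcgAverage α s, (apcgStep f Ψ L α s (i k)).2)
    rw [apcgPoint_step hα]
    have hμn : μ / n = n * α * α := by
      rw [div_eq_iff hn'.ne', hαμ]; ring
    change apcgExtrap α s + (n * α) • ((apcgStep f Ψ L α s (i k)).2 - s.2)
      + (μ / n) • (s.2 - apcgExtrap α s) = _
    rw [hμn, apcgCenter]
    module

/-- The state after `k` steps factors through the first `k` draws. For finite `ι` this settles
measurability and integrability without any structure on `S`, and makes the state independent of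
draw `k`. -/
theorem exists_iterateWith_eq {S ι : Type*} (T : S → ι → S) (s₀ : S) (k : ℕ) :
    ∃ H : (Finset.range k → ι) → S, ∀ i : ℕ → ι, iterateWith T s₀ i k = H fun j => i j := by
  induction k with
  | zero => exact ⟨fun _ => s₀, fun _ => rfl⟩
  | succ k ih =>
    obtain ⟨H, hH⟩ := ih
    refine ⟨fun s => T (H fun j => s ⟨j, Finset.range_subset_range.2 k.le_succ j.2⟩)
      (s ⟨k, Finset.self_mem_range_succ k⟩), fun i => ?_⟩
    rw [iterateWith, hH]

section Random

variable {S : Type*} {n : ℕ} {Ω : Type*} [MeasurableSpace Ω] {prob : Measure Ω}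
  [IsProbabilityMeasure prob] {ξ : ℕ → Ω → Fin n}

theorem integrable_iterateWith (hξ : ∀ j, Measurable (ξ j)) (T : S → Fin n → S) (s₀ : S) (k : ℕ)
    (V : S → ℝ) : Integrable (fun ω => V (iterateWith T s₀ (fun j => ξ j ω) k)) prob := by
  obtain ⟨H, hH⟩ := exists_iterateWith_eq T s₀ k
  simp only [hH]
  have hm : Measurable fun ω => fun j : Finset.range k => ξ j ω :=
    measurable_pi_lambda _ fun j => hξ j
  exact (Integrable.of_finite (μ := prob.map fun ω => fun j : Finset.range k => ξ j ω)
    (f := fun s => V (H s))).comp_measurable hm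

theorem integral_iterateWith_succ (hξ : ∀ j, Measurable (ξ j)) (hind : iIndepFun ξ prob)
    (hunif : ∀ j i, prob {ω | ξ j ω = i} = (n : ENNReal)⁻¹) (T : S → Fin n → S) (s₀ : S) (k : ℕ)
    (V : S → ℝ) :
    ∫ ω, V (iterateWith T s₀ (fun j => ξ j ω) (k + 1)) ∂prob
      = ∫ ω, 1 / n * ∑ i, V (T (iterateWith T s₀ (fun j => ξ j ω) k) i) ∂prob := by
  obtain ⟨H, hH⟩ := exists_iterateWith_eq T s₀ k
  -- Splitting by the value of draw `k` replaces conditional expectation by products of independent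
  -- factors.
  have hdec : ∀ ω, V (iterateWith T s₀ (fun j => ξ j ω) (k + 1))
      = ∑ i, V (T (iterateWith T s₀ (fun j => ξ j ω) k) i) * (if ξ k ω = i then 1 else 0) :=
    fun ω => by simp [iterateWith]
  have hone : ∀ i, ∫ ω, V (T (iterateWith T s₀ (fun j => ξ j ω) k) i)
        * (if ξ k ω = i then 1 else 0) ∂prob
      = (∫ ω, V (T (iterateWith T s₀ (fun j => ξ j ω) k) i) ∂prob) * (1 / n) := fun i => by
    have h1 := hind.indepFun_finset (Finset.range k) {k} (by simp) hξ
    have h2 := h1.comp (φ := fun s => V (T (H s) i))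
      (ψ := fun s => if s ⟨k, by simp⟩ = i then (1 : ℝ) else 0) .of_discrete .of_discrete
    have hm1 : Measurable fun ω => fun j : Finset.range k => ξ j ω :=
      measurable_pi_lambda _ fun j => hξ j
    have hm2 : Measurable fun ω => fun j : ({k} : Finset ℕ) => ξ j ω :=
      measurable_pi_lambda _ fun j => hξ j
    have h3 := h2.integral_mul_eq_mul_integral
      (Measurable.of_discrete.comp hm1).aestronglyMeasurable
      (Measurable.of_discrete.comp hm2).aestronglyMeasurable
    have h4 : ∫ ω, (if ξ k ω = i then (1 : ℝ) else 0) ∂prob = 1 / n := by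
      have hs : MeasurableSet {ω | ξ k ω = i} := hξ k (measurableSet_singleton i)
      have : (fun ω => if ξ k ω = i then (1 : ℝ) else 0)
          = {ω | ξ k ω = i}.indicator fun _ => 1 := by
        ext ω; simp [indicator_apply]
      rw [this, integral_indicator_const _ hs, Measure.real, hunif]
      simp
    simp only [hH]
    rw [← h4]
    exact h3
  have hint : ∀ i ∈ Finset.univ, Integrable (fun ω =>
      V (T (iterateWith T s₀ (fun j => ξ j ω) k) i) * (if ξ k ω = i then 1 else 0)) prob := by
    intro i _
    have hs : MeasurableSet {ω | ξ k ω = i} := hξ k (measurableSet_singleton i)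
    have := (integrable_iterateWith (prob := prob) hξ T s₀ k fun s => V (T s i)).indicator hs
    refine this.congr (Filter.Eventually.of_forall fun ω => ?_)
    simp [indicator_apply]
  simp only [hdec]
  rw [integral_finsetSum _ hint, integral_const_mul, integral_finsetSum _ fun i _ =>
    integrable_iterateWith hξ T s₀ k fun s => V (T s i), Finset.mul_sum]
  exact Finset.sum_congr rfl fun i _ => by rw [hone i, mul_comm]

/-- Geometric decay in expectation of a potential that decreases on average in every step. -/
theorem integral_iterateWith_le (hξ : ∀ j, Measurable (ξ j)) (hind : iIndepFun ξ prob)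
    (hunif : ∀ j i, prob {ω | ξ j ω = i} = (n : ENNReal)⁻¹) (T : S → Fin n → S) (s₀ : S)
    (V : S → ℝ) {ρ : ℝ} (hρ : 0 ≤ ρ) (hV : ∀ s, 1 / n * ∑ i, V (T s i) ≤ ρ * V s) (k : ℕ) :
    ∫ ω, V (iterateWith T s₀ (fun j => ξ j ω) k) ∂prob ≤ ρ ^ k * V s₀ := by
  induction k with
  | zero => simp [iterateWith]
  | succ k ih =>
    rw [integral_iterateWith_succ hξ hind hunif]
    calc _ ≤ ∫ ω, ρ * V (iterateWith T s₀ (fun j => ξ j ω) k) ∂prob :=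
          integral_mono (integrable_iterateWith hξ T s₀ k fun s => 1 / n * ∑ i, V (T s i))
            (integrable_iterateWith hξ T s₀ k fun s => ρ * V s) fun ω => hV _
      _ = ρ * ∫ ω, V (iterateWith T s₀ (fun j => ξ j ω) k) ∂prob := integral_const_mul _ _
      _ ≤ ρ * (ρ ^ k * V s₀) := mul_le_mul_of_nonneg_left ih hρ
      _ = ρ ^ (k + 1) * V s₀ := by ring

end Random

/-! ### The dual of regularized empirical risk minimization -/

section Dual

variable {n d : ℕ} {A : Fin n → EuclideanSpace ℝ (Fin d)} {φ : Fin n → ℝ → ℝ}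
  {g : EuclideanSpace ℝ (Fin d) → ℝ} {lam gam eta R : ℝ}

theorem dataMap_apply (x : EuclideanSpace ℝ (Fin n)) : dataMap A x = ∑ i, x i • A i := by
  simp [dataMap]

theorem dataMap_single (i : Fin n) (t : ℝ) :
    dataMap A (EuclideanSpace.single i t) = t • A i := by
  rw [dataMap_apply, Finset.sum_eq_single i]
  · simp
  · intro j _ hj
    simp [hj]
  · simp

theorem hasFDerivAt_ermSmoothPart (hn : 0 < n) (hlam : 0 < lam)
    (hg : StrongConvexOn univ 1 g) (y : EuclideanSpace ℝ (Fin n)) :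
    HasFDerivAt (ermSmoothPart A g lam gam)
      ((1 / (n : ℝ)) • (innerSL ℝ (primalOfDual A g lam y)).comp (dataMap A)
        + (gam / n) • innerSL ℝ y) y := by
  have hn' : (0 : ℝ) < n := by exact_mod_cast hn
  have h1 := (hg.convexConj_smooth ((1 / (lam * n)) • dataMap A y)).1.hasFDerivAt
  have h2 : HasFDerivAt (fun x => (1 / (lam * n)) • dataMap A x) ((1 / (lam * n)) • dataMap A) y :=
    ((1 / (lam * n)) • dataMap A).hasFDerivAt
  have h3 := (h1.comp y h2).const_mul lam
  have h4 := ((hasFDerivAt_id y).norm_sq).const_mul (gam / (2 * n))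
  refine (h3.add h4).congr_fderiv ?_
  ext v
  simp [primalOfDual]
  field_simp

theorem inner_gradient_ermSmoothPart (hn : 0 < n) (hlam : 0 < lam)
    (hg : StrongConvexOn univ 1 g) (y v : EuclideanSpace ℝ (Fin n)) :
    inner ℝ (gradient (ermSmoothPart A g lam gam) y) v
      = 1 / n * inner ℝ (primalOfDual A g lam y) (dataMap A v) + gam / n * inner ℝ y v := by
  rw [inner_gradient_left, (hasFDerivAt_ermSmoothPart hn hlam hg y).fderiv]
  simp

theorem norm_sq_expand {E : Type*} [NormedAddCommGroup E] [InnerProductSpace ℝ E] (v y : E) :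
    ‖v‖ ^ 2 = ‖y‖ ^ 2 + 2 * inner ℝ y (v - y) + ‖v - y‖ ^ 2 := by
  rw [← norm_add_sq_real, add_sub_cancel]

/-- The term in `g⋆` contributes convexity only; all the curvature comes from the added quadratic.
-/
theorem ermSmoothPart_lower (hn : 0 < n) (hlam : 0 < lam)
    (hg : StrongConvexOn univ 1 g) (y v : EuclideanSpace ℝ (Fin n)) :
    ermSmoothPart A g lam gam y + inner ℝ (gradient (ermSmoothPart A g lam gam) y) (v - y)
      + gam / n / 2 * ‖v - y‖ ^ 2 ≤ ermSmoothPart A g lam gam v := by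
  have hn' : (0 : ℝ) < n := by exact_mod_cast hn
  have h1 := mul_le_mul_of_nonneg_left ((hg.convexConj_smooth
    ((1 / (lam * n)) • dataMap A y)).2.2.1 ((1 / (lam * n)) • dataMap A v)) hlam.le
  rw [← smul_sub, ← map_sub, inner_smul_right, mul_add] at h1
  rw [inner_gradient_ermSmoothPart hn hlam hg]
  simp only [ermSmoothPart]
  rw [norm_sq_expand v y]
  change lam * _ + lam * (1 / (lam * n) * inner ℝ (primalOfDual A g lam y) _) ≤ _ at h1
  have h2 : lam * (1 / (lam * n) * inner ℝ (primalOfDual A g lam y) (dataMap A (v - y)))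
      = 1 / n * inner ℝ (primalOfDual A g lam y) (dataMap A (v - y)) := by field_simp
  have h3 : gam / (2 * n) = gam / n / 2 := by field_simp
  rw [h2] at h1
  rw [h3]
  linarith

theorem ermSmoothPart_upper (hn : 0 < n) (hlam : 0 < lam)
    (hg : StrongConvexOn univ 1 g) (y v : EuclideanSpace ℝ (Fin n)) :
    ermSmoothPart A g lam gam v
      ≤ ermSmoothPart A g lam gam y + inner ℝ (gradient (ermSmoothPart A g lam gam) y) (v - y)
        + 1 / (2 * lam * (n : ℝ) ^ 2) * ‖dataMap A (v - y)‖ ^ 2 + gam / (2 * n) * ‖v - y‖ ^ 2 := by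
  have hn' : (0 : ℝ) < n := by exact_mod_cast hn
  have h1 := mul_le_mul_of_nonneg_left ((hg.convexConj_smooth
    ((1 / (lam * n)) • dataMap A y)).2.2.2 ((1 / (lam * n)) • dataMap A v)) hlam.le
  rw [← smul_sub, ← map_sub, inner_smul_right, norm_smul, mul_pow, Real.norm_eq_abs, sq_abs] at h1
  rw [inner_gradient_ermSmoothPart hn hlam hg]
  simp only [ermSmoothPart]
  rw [norm_sq_expand v y]
  refine (add_le_add_left h1 _).trans_eq ?_
  simp only [primalOfDual]
  field_simp
  ring

theorem ermSmoothPart_coord_upper (hn : 0 < n) (hlam : 0 < lam)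
    (hg : StrongConvexOn univ 1 g) (y : EuclideanSpace ℝ (Fin n)) (i : Fin n) (t : ℝ) :
    ermSmoothPart A g lam gam (y + EuclideanSpace.single i t)
      ≤ ermSmoothPart A g lam gam y + t * gradient (ermSmoothPart A g lam gam) y i
        + ermLip A lam gam i / 2 * t ^ 2 := by
  have hn' : (0 : ℝ) < n := by exact_mod_cast hn
  refine (ermSmoothPart_upper hn hlam hg y _).trans_eq ?_
  rw [add_sub_cancel_left, dataMap_single, norm_smul, mul_pow, PiLp.norm_single,
    Real.norm_eq_abs, sq_abs, EuclideanSpace.inner_single_right, ermLip]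
  simp only [conj_trivial]
  field_simp
  ring

theorem ermLip_pos (hn : 0 < n) (hlam : 0 < lam) (hgam : 0 < gam) (i : Fin n) :
    0 < ermLip A lam gam i := by
  have hn' : (0 : ℝ) < n := by exact_mod_cast hn
  unfold ermLip
  positivity

theorem ermMu_pos (hn : 0 < n) (hlam : 0 < lam) (hgam : 0 < gam) : 0 < ermMu n lam gam R := by
  have hn' : (0 : ℝ) < n := by exact_mod_cast hn
  unfold ermMu
  positivity

theorem ermMu_le_one (hn : 0 < n) (hlam : 0 < lam) (hgam : 0 < gam) : ermMu n lam gam R ≤ 1 := by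
  have hn' : (0 : ℝ) < n := by exact_mod_cast hn
  unfold ermMu
  rw [div_le_one (by positivity)]
  nlinarith [sq_nonneg R]

/-- From `L_i ≤ (R² + lam gam n) / (lam n²)` it follows that `μ L_i ≤ gam / n`, which explains the
value of `μ`. -/
theorem ermMu_mul_weightedNormSq_le (hn : 0 < n) (hlam : 0 < lam) (hgam : 0 < gam)
    (hR : ∀ i, ‖A i‖ ≤ R) (v : EuclideanSpace ℝ (Fin n)) :
    ermMu n lam gam R * weightedNormSq (ermLip A lam gam) v ≤ gam / n * ‖v‖ ^ 2 := by
  have hn' : (0 : ℝ) < n := by exact_mod_cast hn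
  rw [EuclideanSpace.real_norm_sq_eq, weightedNormSq, Finset.mul_sum, Finset.mul_sum]
  refine Finset.sum_le_sum fun i _ => ?_
  rw [← mul_assoc]
  refine mul_le_mul_of_nonneg_right ?_ (sq_nonneg _)
  have hA : ‖A i‖ ^ 2 ≤ R ^ 2 := pow_le_pow_left₀ (norm_nonneg _) (hR i) 2
  have h1 : ermLip A lam gam i ≤ (R ^ 2 + lam * gam * n) / (lam * (n : ℝ) ^ 2) := by
    rw [ermLip, add_div]
    have : lam * gam * n / (lam * (n : ℝ) ^ 2) = gam / n := by field_simp
    rw [this]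
    gcongr
  refine (mul_le_mul_of_nonneg_left h1 (ermMu_pos hn hlam hgam).le).trans_eq ?_
  have : R ^ 2 + lam * gam * n ≠ 0 := by positivity
  rw [ermMu]
  field_simp

theorem convexOn_ermSepPart (hgam : 0 < gam) (heta : 0 < eta)
    (hφ_smooth : ∀ i, IsSmoothFun (1 / gam) (φ i))
    (hφ_convex : ∀ i, StrongConvexOn univ (1 / eta) (φ i)) (i : Fin n) :
    ConvexOn ℝ univ (ermSepPart φ gam i) := by
  rw [← strongConvexOn_zero]
  refine strongConvexOn_of_forall_exists_minorant fun t => ?_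
  obtain ⟨a, ha⟩ := (hφ_smooth i).convexConj_minorant hgam (by positivity) (hφ_convex i) (-t)
  refine ⟨1 / n * (-a - gam * t), fun t' => ?_⟩
  have := mul_le_mul_of_nonneg_left (ha (-t')) (by positivity : 0 ≤ 1 / (n : ℝ))
  simp only [ermSepPart, RCLike.inner_apply, conj_trivial]
  linarith

theorem neg_dualObj_eq (x : EuclideanSpace ℝ (Fin n)) :
    -dualObj A φ g lam x = ermSmoothPart A g lam gam x + ∑ i, ermSepPart φ gam i (x i) := by
  simp only [dualObj, ermSmoothPart, ermSepPart, EuclideanSpace.real_norm_sq_eq, ← Finset.mul_sum,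
    Finset.sum_sub_distrib, Finset.sum_neg_distrib]
  ring

theorem strongConvexOn_neg_dualObj (hn : 0 < n) (hlam : 0 < lam) (hgam : 0 < gam) (heta : 0 < eta)
    (hg : StrongConvexOn univ 1 g) (hφ_smooth : ∀ i, IsSmoothFun (1 / gam) (φ i))
    (hφ_convex : ∀ i, StrongConvexOn univ (1 / eta) (φ i)) :
    StrongConvexOn univ (gam / n) fun x => -dualObj A φ g lam x := by
  have h1 : StrongConvexOn univ (gam / n) (ermSmoothPart A g lam gam) :=
    strongConvexOn_of_forall_exists_minorant fun y => ⟨_, ermSmoothPart_lower hn hlam hg y⟩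
  refine ⟨convex_univ, fun x hx y hy a b ha hb hab => ?_⟩
  have h2 := h1.2 hx hy ha hb hab
  have h3 : ∑ i, ermSepPart φ gam i ((a • x + b • y) i)
      ≤ a * ∑ i, ermSepPart φ gam i (x i) + b * ∑ i, ermSepPart φ gam i (y i) := by
    obtain rfl : a = 1 - b := by linarith
    exact sum_combo_le (convexOn_ermSepPart hgam heta hφ_smooth hφ_convex) hb (by linarith) x y
  simp only [neg_dualObj_eq (gam := gam), smul_eq_mul] at h2 ⊢
  linarith

theorem existsUnique_dualObj_maximizer (hn : 0 < n) (hlam : 0 < lam) (hgam : 0 < gam)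
    (heta : 0 < eta) (hg : StrongConvexOn univ 1 g)
    (hφ_smooth : ∀ i, IsSmoothFun (1 / gam) (φ i))
    (hφ_convex : ∀ i, StrongConvexOn univ (1 / eta) (φ i)) :
    ∃! xs, ∀ x, dualObj A φ g lam x ≤ dualObj A φ g lam xs := by
  have hn' : (0 : ℝ) < n := by exact_mod_cast hn
  have hsc := strongConvexOn_neg_dualObj (A := A) hn hlam hgam heta hg hφ_smooth hφ_convex
  obtain ⟨xs, hxs⟩ := hsc.exists_forall_le (by positivity)
  refine ⟨xs, fun x => neg_le_neg_iff.1 (hxs x), fun y hy => ?_⟩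
  have h1 := hsc.add_norm_sq_le_of_forall_le hxs y
  have h2 := hy xs
  have h3 : ‖y - xs‖ ^ 2 ≤ 0 := by
    by_contra! h
    have : 0 < gam / n / 2 * ‖y - xs‖ ^ 2 := by positivity
    linarith
  have h4 := pow_eq_zero_iff two_ne_zero |>.1 (le_antisymm h3 (sq_nonneg _))
  exact sub_eq_zero.1 (norm_eq_zero.1 h4)

/-- The duality gap at `x` in terms of the dual point `t` with `t i = -φ_i'(⟪A_i, ω(x)⟫)`. -/
theorem primalObj_sub_dualObj_eq (hn : 0 < n) (hlam : 0 < lam) (hg : StrongConvexOn univ 1 g)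
    (hd : ∀ i, Differentiable ℝ (φ i)) (hc : ∀ i, ConvexOn ℝ univ (φ i))
    {x t : EuclideanSpace ℝ (Fin n)}
    (ht : ∀ i, t i = -deriv (φ i) (inner ℝ (A i) (primalOfDual A g lam x))) :
    primalObj A φ g lam (primalOfDual A g lam x) - dualObj A φ g lam x
      = 1 / n * (∑ i, convexConj (φ i) (-x i) - ∑ i, convexConj (φ i) (-t i))
        - 1 / n * inner ℝ (primalOfDual A g lam x) (dataMap A (t - x)) := by
  have hn' : (0 : ℝ) < n := by exact_mod_cast hn
  -- Fenchel-Young holds with equality for `g` at `w` and for each `φ i` at `⟪A_i, w⟫`, which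
  -- eliminates both primal terms.
  have h1 := (hg.convexConj_smooth ((1 / (lam * n)) • dataMap A x)).2.1
  change _ = inner ℝ (primalOfDual A g lam x) _ - g (primalOfDual A g lam x) at h1
  rw [inner_smul_right] at h1
  have h2 : ∀ i, convexConj (φ i) (-t i)
      = -(t i * inner ℝ (A i) (primalOfDual A g lam x))
        - φ i (inner ℝ (A i) (primalOfDual A g lam x)) := fun i => by
    have := convexConj_deriv (hd i) (hc i) (inner ℝ (A i) (primalOfDual A g lam x))
    rw [← neg_eq_iff_eq_neg.2 (ht i)] at this
    rw [this]
    ring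
  have h3 : inner ℝ (primalOfDual A g lam x) (dataMap A t)
      = ∑ i, t i * inner ℝ (A i) (primalOfDual A g lam x) := by
    simp [dataMap_apply, inner_sum, inner_smul_right, real_inner_comm]
  rw [map_sub, inner_sub_right, h3]
  simp only [primalObj, dualObj, h1, h2, Finset.sum_sub_distrib, Finset.sum_neg_distrib]
  field_simp
  ring

/-- The duality gap is controlled by the dual suboptimality. -/
theorem primalObj_sub_dualObj_le (hn : 0 < n) (hlam : 0 < lam) (hgam : 0 < gam) (heta : 0 < eta)
    (hg : StrongConvexOn univ 1 g) (hφ_smooth : ∀ i, IsSmoothFun (1 / gam) (φ i))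
    (hφ_convex : ∀ i, StrongConvexOn univ (1 / eta) (φ i)) {xs : EuclideanSpace ℝ (Fin n)}
    (hxs : ∀ x, dualObj A φ g lam x ≤ dualObj A φ g lam xs) (x : EuclideanSpace ℝ (Fin n)) :
    primalObj A φ g lam (primalOfDual A g lam x) - dualObj A φ g lam x
      ≤ (lam * gam * n + ‖dataMap A‖ ^ 2) / (lam * gam * n)
        * (dualObj A φ g lam xs - dualObj A φ g lam x) := by
  have hn' : (0 : ℝ) < n := by exact_mod_cast hn
  obtain ⟨t, ht⟩ : ∃ t : EuclideanSpace ℝ (Fin n),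
      ∀ i, t i = -deriv (φ i) (inner ℝ (A i) (primalOfDual A g lam x)) :=
    ⟨WithLp.toLp 2 fun i => -deriv (φ i) (inner ℝ (A i) (primalOfDual A g lam x)), fun _ => rfl⟩
  rw [primalObj_sub_dualObj_eq hn hlam hg (fun i => (hφ_smooth i).1)
    (fun i => UniformConvexOn.convexOn (hφ_convex i) fun r => by positivity) ht]
  -- `θ` solves `θ ‖A‖² = lam gam n (1 - θ)`: the smoothness loss of `g⋆` is then covered by the
  -- strong convexity gain of the `φ_i⋆` (`hquad`).
  set θ := lam * gam * n / (lam * gam * n + ‖dataMap A‖ ^ 2) with hθ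
  have hden : 0 < lam * gam * n + ‖dataMap A‖ ^ 2 := by positivity
  have hθ0 : 0 < θ := by positivity
  have hθ1 : θ ≤ 1 := by
    rw [hθ, div_le_one hden]
    linarith [sq_nonneg ‖dataMap A‖]
  set G := 1 / n * (∑ i, convexConj (φ i) (-x i) - ∑ i, convexConj (φ i) (-t i))
        - 1 / n * inner ℝ (primalOfDual A g lam x) (dataMap A (t - x)) with hG
  suffices h : θ * G ≤ dualObj A φ g lam xs - dualObj A φ g lam x by
    calc G = (lam * gam * n + ‖dataMap A‖ ^ 2) / (lam * gam * n) * (θ * G) := by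
          rw [hθ]; field_simp
      _ ≤ _ := mul_le_mul_of_nonneg_left h (by positivity)
  refine le_trans ?_ (sub_le_sub_right (hxs (x + θ • (t - x))) _)
  have hsum : ∑ i, convexConj (φ i) (-(x + θ • (t - x)) i)
      ≤ (1 - θ) * ∑ i, convexConj (φ i) (-x i) + θ * ∑ i, convexConj (φ i) (-t i)
        - gam / 2 * (θ * (1 - θ)) * ‖t - x‖ ^ 2 := by
    rw [EuclideanSpace.real_norm_sq_eq, Finset.mul_sum, Finset.mul_sum, Finset.mul_sum,
      ← Finset.sum_add_distrib, ← Finset.sum_sub_distrib]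
    refine Finset.sum_le_sum fun i _ => ?_
    have hsc : StrongConvexOn univ gam (convexConj (φ i)) :=
      strongConvexOn_of_forall_exists_minorant fun s => by
        obtain ⟨a, ha⟩ :=
          (hφ_smooth i).convexConj_minorant hgam (by positivity) (hφ_convex i) s
        refine ⟨a, fun s' => ?_⟩
        have := ha s'
        simp only [RCLike.inner_apply, conj_trivial, Real.norm_eq_abs, sq_abs]
        linarith
    have := hsc.2 (mem_univ (-x i)) (mem_univ (-t i)) (sub_nonneg.2 hθ1) hθ0.le (by ring)
    have e : (1 - θ) • (-x i) + θ • (-t i) = -(x + θ • (t - x)) i := by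
      simp only [PiLp.add_apply, PiLp.sub_apply, PiLp.smul_apply, smul_eq_mul]
      ring
    rw [e] at this
    simp only [smul_eq_mul, Real.norm_eq_abs, sq_abs] at this
    simp only [PiLp.sub_apply]
    linarith
  have hsum' := mul_le_mul_of_nonneg_left hsum (by positivity : 0 ≤ 1 / (n : ℝ))
  have hup := mul_le_mul_of_nonneg_left ((hg.convexConj_smooth
    ((1 / (lam * n)) • dataMap A x)).2.2.2 ((1 / (lam * n)) • dataMap A (x + θ • (t - x)))) hlam.le
  rw [← smul_sub, ← map_sub, add_sub_cancel_left, map_smul, inner_smul_right, norm_smul, norm_smul,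
    inner_smul_right, mul_pow, mul_pow, Real.norm_eq_abs, Real.norm_eq_abs, sq_abs, sq_abs] at hup
  change _ ≤ lam * (_ + 1 / (lam * n) * (θ * inner ℝ (primalOfDual A g lam x) _) + _) at hup
  have hnorm : ‖dataMap A (t - x)‖ ^ 2 ≤ ‖dataMap A‖ ^ 2 * ‖t - x‖ ^ 2 := by
    rw [← mul_pow]
    exact pow_le_pow_left₀ (norm_nonneg _) ((dataMap A).le_opNorm _) 2
  have hquad : lam * (1 / 2 * ((1 / (lam * n)) ^ 2 * (θ ^ 2 * ‖dataMap A (t - x)‖ ^ 2)))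
      ≤ 1 / n * (gam / 2 * (θ * (1 - θ)) * ‖t - x‖ ^ 2) := by
    have h1 : lam * (1 / 2 * ((1 / (lam * n)) ^ 2 * (θ ^ 2 * ‖dataMap A (t - x)‖ ^ 2)))
        ≤ lam * (1 / 2 * ((1 / (lam * n)) ^ 2 * (θ ^ 2 * (‖dataMap A‖ ^ 2 * ‖t - x‖ ^ 2)))) := by
      gcongr
    refine h1.trans_eq ?_
    have h2 : 1 - θ = ‖dataMap A‖ ^ 2 / (lam * gam * n + ‖dataMap A‖ ^ 2) := by
      rw [hθ]; field_simp; ring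
    rw [h2, hθ]
    field_simp
  have hlin : lam * (1 / (lam * n) * (θ * inner ℝ (primalOfDual A g lam x) (dataMap A (t - x))))
      = θ * (1 / n * inner ℝ (primalOfDual A g lam x) (dataMap A (t - x))) := by
    field_simp
  simp only [dualObj, Finset.sum_neg_distrib]
  rw [hG]
  linarith

end Dual

/-! ### Iteration complexity -/

/-- With `s` the square root, `μ (n² + s²) = n²` exactly, and `n² + s² ≤ (n + s)²`. -/
theorem one_le_rate_mul {n : ℕ} (hn : 0 < n) {lam gam : ℝ} (hlam : 0 < lam) (hgam : 0 < gam)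
    (R : ℝ) :
    1 ≤ √(ermMu n lam gam R) / n * (n + √(n * R ^ 2 / (lam * gam))) := by
  have hn' : (0 : ℝ) < n := by exact_mod_cast hn
  rw [div_mul_eq_mul_div, one_le_div hn']
  have hs := Real.sq_sqrt (by positivity : 0 ≤ n * R ^ 2 / (lam * gam))
  have hs0 := Real.sqrt_nonneg (n * R ^ 2 / (lam * gam))
  have hμ := Real.sq_sqrt (ermMu_pos (R := R) hn hlam hgam).le
  refine le_of_sq_le_sq ?_ (by positivity)
  rw [mul_pow, hμ]
  have h1 : ermMu n lam gam R * ((n : ℝ) ^ 2 + √(n * R ^ 2 / (lam * gam)) ^ 2) = (n : ℝ) ^ 2 := by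
    have : R ^ 2 + lam * gam * n ≠ 0 := by positivity
    rw [hs, ermMu]
    field_simp
    ring
  rw [← h1]
  refine mul_le_mul_of_nonneg_left ?_ (ermMu_pos hn hlam hgam).le
  nlinarith [mul_nonneg hn'.le hs0]

/-- A geometric rate `1 - α` reaches accuracy `ε` after `N log (K C / ε)` steps if `α N ≥ 1`. -/
theorem geometric_le_of_log_le {α N K C ε : ℝ} (hα0 : 0 < α) (hα1 : α ≤ 1) (hαN : 1 ≤ α * N)
    (hK : 0 < K) (hC : 0 ≤ C) (hε : 0 < ε) {k : ℕ} (hk : N * Real.log (K * (C / ε)) ≤ k) :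
    K * ((1 - α) ^ k * C) ≤ ε := by
  rcases hC.eq_or_lt with rfl | hC
  · simpa using hε.le
  have hX : 0 < K * (C / ε) := by positivity
  have hpow : (1 - α) ^ k ≤ Real.exp (-(α * k)) := by
    calc (1 - α) ^ k ≤ Real.exp (-α) ^ k :=
          pow_le_pow_left₀ (by linarith) (Real.one_sub_le_exp_neg α) k
      _ = _ := by rw [← Real.exp_nat_mul]; ring_nf
  suffices h : (1 - α) ^ k * (K * (C / ε)) ≤ 1 by
    calc K * ((1 - α) ^ k * C) = (1 - α) ^ k * (K * (C / ε)) * ε := by field_simp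
      _ ≤ 1 * ε := mul_le_mul_of_nonneg_right h hε.le
      _ = ε := one_mul ε
  refine (mul_le_mul_of_nonneg_right hpow hX.le).trans ?_
  rw [← Real.exp_log hX, ← Real.exp_add, Real.exp_le_one_iff]
  -- `αN ≥ 1` helps only for a nonnegative logarithm; otherwise the exponent is already nonpositive.
  rcases le_total (Real.log (K * (C / ε))) 0 with h | h
  · have : 0 ≤ α * k := by positivity
    linarith
  · nlinarith [mul_le_mul_of_nonneg_left hk hα0.le, mul_le_mul_of_nonneg_right hαN h]

theorem corollary1 {n d : ℕ} (hn : 0 < n)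
    (A : Fin n → EuclideanSpace ℝ (Fin d)) (φ : Fin n → ℝ → ℝ)
    (g : EuclideanSpace ℝ (Fin d) → ℝ) (lam gam eta R : ℝ)
    (hlam : 0 < lam) (hgam : 0 < gam) (heta : 0 < eta)
    (hg : StrongConvexOn Set.univ 1 g)
    (hφ_smooth : ∀ i, IsSmoothFun (1 / gam) (φ i))
    (hφ_convex : ∀ i, StrongConvexOn Set.univ (1 / eta) (φ i))
    (hR : ∀ i, ‖A i‖ ≤ R)
    (x₀ : EuclideanSpace ℝ (Fin n))
    {Ω : Type*} [MeasurableSpace Ω] (prob : Measure Ω) [IsProbabilityMeasure prob]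
    (ξ : ℕ → Ω → Fin n) (hξ_meas : ∀ j, Measurable (ξ j)) (hξ_indep : iIndepFun ξ prob)
    (hξ_unif : ∀ j i, prob {ω | ξ j ω = i} = (n : ENNReal)⁻¹) :
    (∃! xstar, ∀ x, dualObj A φ g lam x ≤ dualObj A φ g lam xstar) ∧
    ∀ xstar, (∀ x, dualObj A φ g lam x ≤ dualObj A φ g lam xstar) →
      ∀ C : ℝ, C = dualObj A φ g lam xstar - dualObj A φ g lam x₀
          + gam / (2 * n) * ‖x₀ - xstar‖ ^ 2 →
      ∀ ε : ℝ, 0 < ε → ∀ k : ℕ,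
        (n + √(n * R ^ 2 / (lam * gam)))
            * Real.log ((lam * eta * n + ‖dataMap A‖ ^ 2) / (lam * gam * n) * (C / ε)) ≤ k →
        Integrable (fun ω =>
          primalObj A φ g lam (primalOfDual A g lam
              (ermIterate A φ g lam gam R x₀ (fun j => ξ j ω) k))
            - dualObj A φ g lam (ermIterate A φ g lam gam R x₀ (fun j => ξ j ω) k)) prob ∧
        ∫ ω, (primalObj A φ g lam (primalOfDual A g lam
              (ermIterate A φ g lam gam R x₀ (fun j => ξ j ω) k))
            - dualObj A φ g lam (ermIterate A φ g lam gam R x₀ (fun j => ξ j ω) k)) ∂prob ≤ ε := by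

  refine ⟨existsUnique_dualObj_maximizer hn hlam hgam heta hg hφ_smooth hφ_convex, ?_⟩
  intro xs hxs C hC ε hε k hk
  have hn' : (0 : ℝ) < n := by exact_mod_cast hn
  set μ := ermMu n lam gam R with hμdef
  have hμ : 0 < μ := ermMu_pos hn hlam hgam
  set α := √μ / n with hαdef
  have hα : 0 < α := by positivity
  have hnα : n * α = √μ := mul_div_cancel₀ _ hn'.ne'
  have hαμ : ((n : ℝ) * α) ^ 2 = μ := by rw [hnα, Real.sq_sqrt hμ.le]
  have hnα1 : n * α ≤ 1 := by
    rw [hnα]; exact Real.sqrt_le_one.2 (ermMu_le_one hn hlam hgam)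
  have hα1 : α ≤ 1 := by
    have : (1 : ℝ) ≤ n := by exact_mod_cast hn
    nlinarith
  set f := ermSmoothPart A g lam gam with hf
  set Ψ := ermSepPart φ gam with hΨdef
  set L := ermLip A lam gam with hLdef
  have hL : ∀ i, 0 < L i := ermLip_pos hn hlam hgam
  have hΨ : ∀ i, ConvexOn ℝ univ (Ψ i) := convexOn_ermSepPart hgam heta hφ_smooth hφ_convex
  have hμL : ∀ v, μ / 2 * weightedNormSq L v ≤ gam / n / 2 * ‖v‖ ^ 2 := fun v => by
    linarith [ermMu_mul_weightedNormSq_le hn hlam hgam hR v]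
  have hlow : ∀ y v, f y + inner ℝ (gradient f y) (v - y) + μ / 2 * weightedNormSq L (v - y)
      ≤ f v := fun y v => by
    linarith [ermSmoothPart_lower (A := A) (gam := gam) hn hlam hg y v, hμL (v - y)]
  let T := apcgStep f Ψ L α
  let V := apcgPotential f Ψ L α μ xs
  have hiter : ∀ i, ermIterate A φ g lam gam R x₀ i k
      = apcgPoint α (iterateWith T (x₀, x₀) i k) := fun i => by
    rw [ermIterate, apcg_eq_iterateWith hn _ _ _ hμ]
  simp only [hiter]
  have hdecay := integral_iterateWith_le hξ_meas hξ_indep hξ_unif T (x₀, x₀) V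
    (sub_nonneg.2 hα1) (average_apcgPotential_step_le hn hα hnα1 hαμ hL hΨ
      (ermSmoothPart_coord_upper hn hlam hg) hlow xs) k
  -- Here `p = z = x = x₀`, so the potential is the dual gap plus the weighted distance, which `hμL`
  -- bounds by the Euclidean term of `C`.
  have hV0 : V (x₀, x₀) ≤ C := by
    have hx : apcgPoint α (x₀, x₀) = x₀ := by rw [apcgPoint]; module
    have h1 := neg_dualObj_eq (A := A) (φ := φ) (g := g) (lam := lam) (gam := gam) x₀
    have h2 := neg_dualObj_eq (A := A) (φ := φ) (g := g) (lam := lam) (gam := gam) xs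
    have h3 := hμL (x₀ - xs)
    have h4 : gam / n / 2 = gam / (2 * n) := by field_simp
    rw [h4] at h3
    simp only [V, apcgPotential, hx]
    rw [hC]
    linarith
  have hC0 : 0 ≤ C := by
    have : 0 ≤ gam / (2 * n) * ‖x₀ - xs‖ ^ 2 := by positivity
    linarith [hxs x₀]
  have heg : gam ≤ eta := by
    have := (hφ_smooth ⟨0, hn⟩).strongConvexOn_le (by positivity) (hφ_convex ⟨0, hn⟩)
    exact (one_div_le_one_div heta hgam).1 this
  set K := (lam * eta * n + ‖dataMap A‖ ^ 2) / (lam * gam * n) with hK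
  have hK0 : 0 < K := by positivity
  have hgap : ∀ s, primalObj A φ g lam (primalOfDual A g lam (apcgPoint α s))
      - dualObj A φ g lam (apcgPoint α s) ≤ K * V s := fun s => by
    have h1 := primalObj_sub_dualObj_le hn hlam hgam heta hg hφ_smooth hφ_convex hxs (apcgPoint α s)
    have h2 : (lam * gam * n + ‖dataMap A‖ ^ 2) / (lam * gam * n) ≤ K := by
      rw [hK]; gcongr
    have h3 := le_apcgPotential hμ.le hα.le hnα1 hL hΨ xs s (f := f)
    rw [← neg_dualObj_eq, ← neg_dualObj_eq] at h3
    calc _ ≤ _ := h1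
      _ ≤ K * (dualObj A φ g lam xs - dualObj A φ g lam (apcgPoint α s)) :=
        mul_le_mul_of_nonneg_right h2 (sub_nonneg.2 (hxs _))
      _ ≤ K * V s := mul_le_mul_of_nonneg_left (by linarith) hK0.le
  have hint := integrable_iterateWith (prob := prob) hξ_meas T (x₀, x₀) k fun s =>
    primalObj A φ g lam (primalOfDual A g lam (apcgPoint α s)) - dualObj A φ g lam (apcgPoint α s)
  refine ⟨hint, ?_⟩
  calc _ ≤ ∫ ω, K * V (iterateWith T (x₀, x₀) (fun j => ξ j ω) k) ∂prob :=
        integral_mono hint (integrable_iterateWith hξ_meas T (x₀, x₀) k fun s => K * V s)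
          fun ω => hgap _
    _ = K * ∫ ω, V (iterateWith T (x₀, x₀) (fun j => ξ j ω) k) ∂prob := integral_const_mul _ _
    _ ≤ K * ((1 - α) ^ k * C) := mul_le_mul_of_nonneg_left
        (hdecay.trans (mul_le_mul_of_nonneg_left hV0 (pow_nonneg (sub_nonneg.2 hα1) k))) hK0.le
    _ ≤ ε := geometric_le_of_log_le hα hα1 (one_le_rate_mul hn hlam hgam R) hK0 hC0 hε hk
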